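/- A numerical semigroup is a submonoid $S$ of $(\mathbb{N},+)$ (with $0\in\mathbb{N}$) whose complement in $\mathbb{N}$ is finite. Let $f(S)$ be its Frobenius number, i.e. the largest integer not belonging to $S$ (so $f(\mathbb{N})=-1$); let $m(S)=\min\{s\in S : s>0\}$ be its multiplicity; let $\nu(S)$ be its embedding dimension, i.e. the number of elements of its unique minimal system of generators; and let $n(S)=|\{s\in S : s<f(S)\}|$. We say that $S$ satisfies Wilf's conjecture if $f(S)+1\le n(S)\,\nu(S)$. **Corollary.** Every numerical semigroup $S$ with $m(S)\le 6$ satisfies Wilf's conjecture, that is, $f(S)+1\le n(S)\,\nu(S)$. -/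

import Mathlib

namespace NumSemigroup

/-- A numerical semigroup is a submonoid of `(ℕ, +)` with finite complement in `ℕ`. -/
def IsNumericalSemigroup (S : AddSubmonoid ℕ) : Prop :=
  ((S : Set ℕ)ᶜ).Finite

/-- The Frobenius number `f(S)`: the largest integer not belonging to `S`.
It is an integer, and equals `-1` for `S = ℕ`. -/
noncomputable def frobeniusNumber (S : AddSubmonoid ℕ) : ℤ :=
  sSup {x : ℤ | ∀ s ∈ S, (s : ℤ) ≠ x}

/-- The multiplicity `m(S)`: the least positive element of `S`. -/
noncomputable def mult (S : AddSubmonoid ℕ) : ℕ :=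
  sInf {s : ℕ | s ∈ S ∧ 0 < s}

/-- The relation `s ⪯ t` induced by `S`: there is `u ∈ S` with `s + u = t`. -/
def Prec (S : AddSubmonoid ℕ) (s t : ℕ) : Prop :=
  ∃ u ∈ S, s + u = t

/-- The minimal system of generators of `S`, that is, the set of minimal elements of `S \ {0}`
with respect to `⪯`. -/
def minGenerators (S : AddSubmonoid ℕ) : Set ℕ :=
  {g : ℕ | g ∈ S ∧ g ≠ 0 ∧ ∀ s ∈ S, s ≠ 0 → Prec S s g → s = g}

/-- The embedding dimension `ν(S)`: the number of minimal generators. -/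
noncomputable def embDim (S : AddSubmonoid ℕ) : ℕ :=
  (minGenerators S).ncard

/-- `n(S)`: the number of elements of `S` smaller than the Frobenius number. -/
noncomputable def numSmall (S : AddSubmonoid ℕ) : ℕ :=
  {s : ℕ | s ∈ S ∧ (s : ℤ) < frobeniusNumber S}.ncard

/-- `S` satisfies Wilf's conjecture: `f(S) + 1 ≤ n(S) ν(S)`. -/
def SatisfiesWilf (S : AddSubmonoid ℕ) : Prop :=
  frobeniusNumber S + 1 ≤ (numSmall S : ℤ) * (embDim S : ℤ)

/-- The supremum defining the Frobenius number is attained. -/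
theorem isGreatest_frobeniusNumber {S : AddSubmonoid ℕ} (hS : IsNumericalSemigroup S) :
    IsGreatest {x : ℤ | ∀ s ∈ S, (s : ℤ) ≠ x} (frobeniusNumber S) := by
  have hne : {x : ℤ | ∀ s ∈ S, (s : ℤ) ≠ x}.Nonempty := ⟨-1, fun s _ => by omega⟩
  have hbd : BddAbove {x : ℤ | ∀ s ∈ S, (s : ℤ) ≠ x} := by
    obtain ⟨b, hb⟩ := hS.bddAbove
    refine ⟨b, fun x hx => ?_⟩
    rcases le_or_gt 0 x with h | h
    · lift x to ℕ using h
      have : x ∈ (S : Set ℕ)ᶜ := fun hxS => hx x hxS rfl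
      exact_mod_cast hb this
    · omega
  exact ⟨Int.csSup_mem hne hbd, fun x hx => le_csSup hbd hx⟩

/-- The infimum defining the multiplicity is attained. -/
theorem isLeast_mult {S : AddSubmonoid ℕ} (hS : IsNumericalSemigroup S) :
    IsLeast {s : ℕ | s ∈ S ∧ 0 < s} (mult S) := by
  have hne : {s : ℕ | s ∈ S ∧ 0 < s}.Nonempty := by
    obtain ⟨b, hb⟩ := hS.bddAbove
    refine ⟨b + 1, ?_, Nat.succ_pos b⟩
    by_contra h
    have := hb (show b + 1 ∈ (S : Set ℕ)ᶜ from h)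
    omega
  exact ⟨Nat.sInf_mem hne, fun x hx => Nat.sInf_le hx⟩

/-- The minimal generators generate `S`. -/
theorem closure_minGenerators (S : AddSubmonoid ℕ) :
    AddSubmonoid.closure (minGenerators S) = S := by
  apply le_antisymm
  · exact (AddSubmonoid.closure_le).2 fun g hg => hg.1
  · intro x
    induction x using Nat.strong_induction_on with
    | _ x ih =>
      intro hx
      by_cases h0 : x = 0
      · subst h0; exact zero_mem _
      by_cases hg : x ∈ minGenerators S
      · exact AddSubmonoid.subset_closure hg
      · have : ∃ s ∈ S, s ≠ 0 ∧ Prec S s x ∧ s ≠ x := by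
          by_contra hcon
          push Not at hcon
          exact hg ⟨hx, h0, fun s hs hs0 hp => hcon s hs hs0 hp⟩
        obtain ⟨s, hs, hs0, ⟨u, hu, rfl⟩, hne⟩ := this
        exact add_mem (ih s (by omega) hs) (ih u (by omega) hu)

/-- Every system of generators of `S` contains the minimal generators; together with the previous
fact, `minGenerators S` is the unique minimal system of generators. -/
theorem minGenerators_subset {S : AddSubmonoid ℕ} {A : Set ℕ}
    (hA : AddSubmonoid.closure A = S) : minGenerators S ⊆ A := by
  rintro g ⟨hgS, hg0, hmin⟩
  have key : ∀ x ∈ AddSubmonoid.closure A, x ≠ 0 → ∃ a ∈ A, a ≠ 0 ∧ Prec S a x := by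
    intro x hx
    induction hx using AddSubmonoid.closure_induction with
    | mem x hx => exact fun h => ⟨x, hx, h, 0, zero_mem _, rfl⟩
    | zero => exact fun h => absurd rfl h
    | add x y hx hy ihx ihy =>
      intro h
      by_cases hx0 : x = 0
      · subst hx0
        simpa using ihy (by simpa using h)
      · obtain ⟨a, ha, ha0, u, hu, rfl⟩ := ihx hx0
        exact ⟨a, ha, ha0, u + y, add_mem hu (hA ▸ hy), by omega⟩
  obtain ⟨a, ha, ha0, hp⟩ := key g (hA ▸ hgS) hg0
  have := hmin a (hA ▸ AddSubmonoid.subset_closure ha) ha0 hp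
  exact this ▸ ha

/-- The set of minimal generators is finite. -/
theorem finite_minGenerators {S : AddSubmonoid ℕ} (hS : IsNumericalSemigroup S) :
    (minGenerators S).Finite := by
  obtain ⟨⟨hmS, hm0⟩, -⟩ := isLeast_mult hS
  have aux : ∀ a ∈ minGenerators S, ∀ b ∈ minGenerators S, a ≤ b →
      a % mult S = b % mult S → a = b := by
    intro a ha b hb hab h
    obtain ⟨k, hk⟩ := (Nat.modEq_iff_dvd' hab).1 h
    refine hb.2.2 a ha.1 ha.2.1 ⟨mult S * k, ?_, by omega⟩
    rw [mul_comm, ← smul_eq_mul]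
    exact nsmul_mem hmS k
  refine Set.Finite.of_finite_image (f := fun g => g % mult S)
    ((Set.finite_Iio (mult S)).subset ?_) ?_
  · rintro _ ⟨g, -, rfl⟩
    exact Nat.mod_lt _ hm0
  · intro a ha b hb h
    rcases le_total a b with hab | hab
    · exact aux a ha b hb hab h
    · exact (aux b hb a ha hab h.symm).symm

end NumSemigroup

namespace NumSemigroup

/-! Write the least element of `S` in class `i` modulo `m = mult S` as `m * k i + i`. The largest of
these, in class `M`, equals `f + m`, so `f + 1 = m * (k M - 1) + M + 1`. Counting class by class
bounds `n(S)` below by a linear form in the `k i`, and `ν(S)` is at least one plus the number of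
indecomposable nonzero Apéry elements. Wilf's inequality thus follows from `wilf_kunz`, a statement
about integers `k i` satisfying the Kunz inequalities. For `m ≤ 6` there are finitely many choices
of `m`, `M` and the set of indecomposable classes. Each choice makes the second factor a numeral,
leaving linear arithmetic. -/

/-- The least element of `S` in the residue class of `i` modulo `m`. -/
noncomputable def apery (S : AddSubmonoid ℕ) (m i : ℕ) : ℕ :=
  sInf {s : ℕ | s ∈ S ∧ s % m = i}

/-! ### Apéry elements -/

section Apery

variable {S : AddSubmonoid ℕ} {m i j : ℕ}

theorem apery_isLeast (hS : IsNumericalSemigroup S) (hi : i < m) :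
    IsLeast {s : ℕ | s ∈ S ∧ s % m = i} (apery S m i) := by
  have hne : {s : ℕ | s ∈ S ∧ s % m = i}.Nonempty := by
    obtain ⟨b, hb⟩ := hS.bddAbove
    refine ⟨m * (b + 1) + i, ?_, by rw [Nat.mul_add_mod, Nat.mod_eq_of_lt hi]⟩
    by_contra h
    have h1 := hb (show m * (b + 1) + i ∈ (S : Set ℕ)ᶜ from h)
    have h2 : 1 * (b + 1) ≤ m * (b + 1) := Nat.mul_le_mul_right _ (by omega)
    omega
  exact ⟨Nat.sInf_mem hne, fun x hx => Nat.sInf_le hx⟩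

theorem apery_mem (hS : IsNumericalSemigroup S) (hi : i < m) : apery S m i ∈ S :=
  (apery_isLeast hS hi).1.1

theorem apery_mod (hS : IsNumericalSemigroup S) (hi : i < m) : apery S m i % m = i :=
  (apery_isLeast hS hi).1.2

theorem apery_le {s : ℕ} (hs : s ∈ S) : apery S m (s % m) ≤ s :=
  Nat.sInf_le ⟨hs, rfl⟩

theorem apery_zero : apery S m 0 = 0 :=
  Nat.le_zero.1 (by simpa using apery_le (m := m) (zero_mem S))

/-- The sum lies in `S`, in the class of `i + j`. Divided by `m`, these become the Kunz
inequalities. -/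
theorem apery_add_le (hS : IsNumericalSemigroup S) (hi : i < m) (hj : j < m) :
    apery S m ((i + j) % m) ≤ apery S m i + apery S m j := by
  have h := apery_le (m := m) (add_mem (apery_mem hS hi) (apery_mem hS hj))
  rwa [Nat.add_mod, apery_mod hS hi, apery_mod hS hj] at h

theorem apery_add_mul_mem (hS : IsNumericalSemigroup S) (hmS : m ∈ S) (hi : i < m) (q : ℕ) :
    apery S m i + m * q ∈ S := by
  refine add_mem (apery_mem hS hi) ?_
  rw [mul_comm, ← smul_eq_mul]
  exact nsmul_mem hmS q

theorem mem_iff_apery_le (hS : IsNumericalSemigroup S) (hmS : m ∈ S) (hm : 0 < m) {s : ℕ} :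
    s ∈ S ↔ apery S m (s % m) ≤ s := by
  refine ⟨apery_le, fun h => ?_⟩
  have hi := Nat.mod_lt s hm
  obtain ⟨q, hq⟩ := (Nat.modEq_iff_dvd' h).1 (apery_mod hS hi)
  have := apery_add_mul_mem hS hmS hi q
  rwa [show apery S m (s % m) + m * q = s by omega] at this

theorem pos_apery (hS : IsNumericalSemigroup S) (hi : i < m) (hi0 : 0 < i) : 0 < apery S m i := by
  refine Nat.pos_of_ne_zero fun h => ?_
  have := apery_mod hS hi
  simp [h] at this
  omega

/-- A nonzero Apéry element that is not a minimal generator is a sum of two nonzero Apéry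
elements. -/
theorem exists_apery_add_of_notMem_minGenerators (hS : IsNumericalSemigroup S) (hi : i < m)
    (hi0 : 0 < i) (h : apery S m i ∉ minGenerators S) :
    ∃ j < m, ∃ l < m, 0 < j ∧ 0 < l ∧ (j + l) % m = i ∧
      apery S m i = apery S m j + apery S m l := by
  have hcon : ∃ s ∈ S, s ≠ 0 ∧ Prec S s (apery S m i) ∧ s ≠ apery S m i := by
    by_contra hcon
    push Not at hcon
    exact h ⟨apery_mem hS hi, (pos_apery hS hi hi0).ne', fun s hs hs0 hp => hcon s hs hs0 hp⟩
  obtain ⟨s, hs, hs0, ⟨u, hu, hsu⟩, hne⟩ := hcon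
  have hm : 0 < m := by omega
  have hmod : (s % m + u % m) % m = i := by
    rw [← Nat.add_mod, hsu, apery_mod hS hi]
  have h1 := apery_le (m := m) hs
  have h2 := apery_le (m := m) hu
  have h3 := apery_add_le hS (Nat.mod_lt s hm) (Nat.mod_lt u hm)
  rw [hmod] at h3
  -- `h1`, `h2`, `h3` squeeze to equality. If one residue were zero, the Apéry element would be at
  -- most the other summand, which is strictly smaller.
  refine ⟨s % m, Nat.mod_lt _ hm, u % m, Nat.mod_lt _ hm, Nat.pos_of_ne_zero fun h0 => ?_,
    Nat.pos_of_ne_zero fun h0 => ?_, hmod, by omega⟩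
  · rw [h0, apery_zero] at h1 h3
    omega
  · rw [h0, apery_zero] at h2 h3
    omega

open Classical in
/-- The multiplicity and the indecomposable Apéry elements are minimal generators. -/
theorem one_add_sum_le_embDim (hS : IsNumericalSemigroup S) :
    1 + ∑ i ∈ Finset.Ico 1 (mult S), (if apery S (mult S) i ∈ minGenerators S then 1 else 0) ≤
      embDim S := by
  obtain ⟨⟨hmS, hm0⟩, hmin⟩ := isLeast_mult hS
  set m := mult S with hm
  have hmg : m ∈ minGenerators S := by
    refine ⟨hmS, hm0.ne', fun s hs hs0 ⟨u, hu, hsu⟩ => ?_⟩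
    have := hmin ⟨hs, Nat.pos_of_ne_zero hs0⟩
    omega
  set A := {i ∈ Finset.Ico 1 m | apery S m i ∈ minGenerators S} with hA
  have hlt : ∀ i ∈ A, i < m := fun i hi => by
    rw [hA, Finset.mem_filter, Finset.mem_Ico] at hi
    exact hi.1.2
  have hinj : Set.InjOn (apery S m) A := fun i hi j hj h => by
    rw [← apery_mod hS (hlt i hi), h, apery_mod hS (hlt j hj)]
  have hnot : m ∉ A.image (apery S m) := by
    intro h
    obtain ⟨i, hi, him⟩ := Finset.mem_image.1 h
    have h1 := apery_mod hS (hlt i hi)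
    rw [him, Nat.mod_self] at h1
    rw [hA, Finset.mem_filter, Finset.mem_Ico] at hi
    omega
  rw [← Finset.card_filter, ← hA, ← Finset.card_image_of_injOn hinj, add_comm,
    ← Finset.card_insert_of_notMem hnot, embDim, ← Set.ncard_coe_finset]
  refine Set.ncard_le_ncard (fun x hx => ?_) (finite_minGenerators hS)
  rw [Finset.mem_coe, Finset.mem_insert, Finset.mem_image] at hx
  obtain rfl | ⟨i, hi, rfl⟩ := hx
  · exact hmg
  · rw [hA, Finset.mem_filter] at hi
    exact hi.2

/-- Counting the elements below the Frobenius number in the residue classes modulo `m`. -/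
theorem sum_le_numSmall (hS : IsNumericalSemigroup S) (hmS : m ∈ S) (hm : 0 < m)
    {k b : ℕ → ℕ} (hk : ∀ i < m, apery S m i = m * k i + i)
    (hb : ∀ i < m, ∀ q, k i ≤ q → q < b i → ((m * q + i : ℕ) : ℤ) < frobeniusNumber S) :
    ∑ i ∈ Finset.range m, (b i - k i) ≤ numSmall S := by
  set A := (Finset.range m).sigma fun i => Finset.Ico (k i) (b i) with hA
  have hmem : ∀ x ∈ A, x.1 < m ∧ k x.1 ≤ x.2 ∧ x.2 < b x.1 := fun x hx => by
    simpa [hA] using hx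
  have hmod : ∀ x ∈ A, (m * x.2 + x.1) % m = x.1 := fun x hx => by
    rw [Nat.mul_add_mod, Nat.mod_eq_of_lt (hmem x hx).1]
  have hinj : Set.InjOn (fun x : (_ : ℕ) × ℕ => m * x.2 + x.1) A := by
    rintro ⟨i, p⟩ hx ⟨j, q⟩ hy h
    have h1 : i = j := by
      have := hmod _ hx
      simp only at h this
      rw [← this, h]
      exact hmod _ hy
    subst h1
    simp only [add_left_inj] at h
    rw [Nat.eq_of_mul_eq_mul_left hm h]
  have hcard : A.card = ∑ i ∈ Finset.range m, (b i - k i) := by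
    simp [hA]
  rw [← hcard, ← Finset.card_image_of_injOn hinj, numSmall, ← Set.ncard_coe_finset]
  refine Set.ncard_le_ncard (fun s hs => ?_) ?_
  · rw [Finset.mem_coe, Finset.mem_image] at hs
    obtain ⟨x, hx, rfl⟩ := hs
    obtain ⟨hi, hkq, hqb⟩ := hmem x hx
    refine ⟨(mem_iff_apery_le hS hmS hm).2 ?_, hb _ hi _ hkq hqb⟩
    rw [hmod x hx, hk _ hi]
    gcongr
  · refine (Set.finite_Iio (frobeniusNumber S).toNat).subset fun s hs => ?_
    have := hs.2
    rw [Set.mem_Iio]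
    omega

end Apery
-- Wilf's inequality in Kunz coordinates
set_option maxHeartbeats 4000000 in
/-- The inequality of Wilf in Kunz coordinates. Here `m * k i + i` are the Apéry elements, the
largest of which is `m * k M + M`, and `g i = 0` only if the `i`-th Apéry element is a sum of two
nonzero ones. -/
theorem wilf_kunz {m M : ℕ} (hm : m ≤ 6) (hM0 : 0 < M) (hMm : M < m) {k g : ℕ → ℤ}
    (hk0 : k 0 = 0) (hpos : ∀ i < m, 0 < i → 0 < k i)
    (hadd : ∀ i < m, ∀ j < m, k ((i + j) % m) ≤ k i + k j + ((i + j) / m : ℕ))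
    (hle : ∀ i < m, i ≤ M → k i ≤ k M) (hlt : ∀ i < m, M < i → k i < k M)
    (hg : ∀ i < m, 0 < i → g i = 1 ∨ g i = 0 ∧ ∃ j < m, ∃ l < m, 0 < j ∧ j ≤ l ∧
      (j + l) % m = i ∧ k i = k j + k l + ((j + l) / m : ℕ)) :
    m * (k M - 1) + M + 1 ≤
      (∑ i ∈ Finset.range m, ((if i ≤ M then k M else k M - 1) - k i)) *
        (1 + ∑ i ∈ Finset.Ico 1 m, g i) := by
  have hm0 : 2 ≤ m := by omega
  interval_cases m <;>
    simp [Nat.forall_lt_succ_right, Nat.exists_lt_succ_right, Nat.le_one_iff_eq_zero_or_eq_one,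
      hk0] at hpos hadd hg <;>
    interval_cases M <;>
    simp [Nat.forall_lt_succ_right, Nat.le_one_iff_eq_zero_or_eq_one, Finset.sum_Ico_eq_sum_range,
      Finset.sum_range_succ, hk0] at hle hlt ⊢
  -- For `m = 2` no decomposition is possible, so `hg` has become `g 1 = 1`.
  · simp only [hg]
    omega
  iterate 2
    obtain ⟨h1 | ⟨h1, hd1⟩, h2 | ⟨h2, hd2⟩⟩ := hg <;>
      simp only [h1, h2] <;> omega
  iterate 3
    obtain ⟨⟨h1 | ⟨h1, hd1⟩, h2 | ⟨h2, hd2⟩⟩, h3 | ⟨h3, hd3⟩⟩ := hg <;>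
      simp only [h1, h2, h3] <;> omega
  iterate 4
    obtain ⟨⟨⟨h1 | ⟨h1, hd1⟩, h2 | ⟨h2, hd2⟩⟩, h3 | ⟨h3, hd3⟩⟩, h4 | ⟨h4, hd4⟩⟩ := hg <;>
      simp only [h1, h2, h3, h4] <;> omega
  iterate 5
    obtain ⟨⟨⟨⟨h1 | ⟨h1, hd1⟩, h2 | ⟨h2, hd2⟩⟩, h3 | ⟨h3, hd3⟩⟩, h4 | ⟨h4, hd4⟩⟩, h5 | ⟨h5, hd5⟩⟩ := hg <;>
      simp only [h1, h2, h3, h4, h5] <;> omega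

/-! ### The Frobenius number and the conclusion -/

/-- The Apéry element in the class of the Frobenius number `f` is `f + m`, and it is the largest. -/
theorem exists_apery_eq_frobeniusNumber_add {S : AddSubmonoid ℕ} {m : ℕ}
    (hS : IsNumericalSemigroup S) (hmS : m ∈ S) (hm : 0 < m) (hf : 0 ≤ frobeniusNumber S) :
    ∃ M < m, 0 < M ∧ (apery S m M : ℤ) = frobeniusNumber S + m ∧
      ∀ i < m, apery S m i ≤ apery S m M := by
  obtain ⟨hfS, hmax⟩ := isGreatest_frobeniusNumber hS
  obtain ⟨f, hfe⟩ := Int.eq_ofNat_of_zero_le hf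
  rw [hfe] at hfS hmax ⊢
  have hfS' : f ∉ S := fun h => hfS f h rfl
  have hmem : ∀ s, f < s → s ∈ S := fun s hs => by
    by_contra h
    have := hmax (show (s : ℤ) ∈ _ from fun t ht hts => h (by rwa [← Int.natCast_inj.1 hts]))
    omega
  have hM := Nat.mod_lt f hm
  have hnot : ∀ s, s % m = f % m → s ≤ f → s ∉ S := fun s hs hsf h => hfS' <| by
    rw [mem_iff_apery_le hS hmS hm, ← hs]
    exact (apery_le h).trans hsf
  -- Otherwise subtracting `m` gives a smaller element of `S` in the same class, as everything above
  -- `f` is in `S`.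
  have key : ∀ i < m, apery S m i ≤ f + m := fun i hi => by
    by_contra hcon
    have h1 := apery_le (m := m) (hmem (apery S m i - m) (by omega))
    rw [← Nat.mod_eq_sub_mod (by omega), apery_mod hS hi] at h1
    omega
  have heq : apery S m (f % m) = f + m := by
    refine le_antisymm (key _ hM) ?_
    by_contra hcon
    have h1 := apery_mod hS hM
    have h2 : f < apery S m (f % m) := by
      by_contra h
      exact hnot _ h1 (by omega) (apery_mem hS hM)
    have h3 := (Nat.modEq_iff_dvd' h2.le).1 h1.symm
    have := Nat.le_of_dvd (by omega) h3
    omega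
  refine ⟨f % m, hM, Nat.pos_of_ne_zero fun h0 => ?_, by rw [heq]; push_cast; ring,
    fun i hi => heq ▸ key i hi⟩
  rw [h0, apery_zero] at heq
  omega

/-- This makes the Kunz coordinates of nonzero classes positive. -/
theorem mult_le_apery {S : AddSubmonoid ℕ} {i : ℕ} (hS : IsNumericalSemigroup S)
    (hi : i < mult S) (hi0 : 0 < i) : mult S ≤ apery S (mult S) i :=
  (isLeast_mult hS).2 ⟨apery_mem hS hi, pos_apery hS hi hi0⟩

end NumSemigroup

open NumSemigroup in
theorem mainTheorem6 (S : AddSubmonoid ℕ) (hS : NumSemigroup.IsNumericalSemigroup S)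
    (hm : NumSemigroup.mult S ≤ 6) : NumSemigroup.SatisfiesWilf S := by
  classical
  obtain ⟨⟨hmS, hm0⟩, -⟩ := isLeast_mult hS
  have hν := one_add_sum_le_embDim hS
  have hpos := fun i => mult_le_apery (i := i) hS
  unfold SatisfiesWilf
  -- A negative `f` (the case `S = ℕ`) makes the left side nonpositive.
  rcases lt_or_ge (frobeniusNumber S) 0 with hf | hf
  · have : (0 : ℤ) ≤ (numSmall S : ℤ) * (embDim S : ℤ) := by positivity
    omega
  generalize mult S = m at *
  obtain ⟨M, hMm, hM0, hMf, hMmax⟩ := exists_apery_eq_frobeniusNumber_add hS hmS hm0 hf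
  set k : ℕ → ℕ := fun i => apery S m i / m with hkdef
  have hk : ∀ i < m, apery S m i = m * k i + i := fun i hi => by
    conv_lhs => rw [← Nat.div_add_mod (apery S m i) m, apery_mod hS hi]
  have hk0 : k 0 = 0 := by simp [hkdef, apery_zero]
  have hkpos : ∀ i < m, 0 < i → 0 < k i := fun i hi hi0 => Nat.div_pos (hpos i hi hi0) hm0
  have hle : ∀ i < m, k i ≤ k M := fun i hi => Nat.div_le_div_right (hMmax i hi)
  have hlt : ∀ i < m, M < i → k i < k M := fun i hi hMi => by
    have h1 := hMmax i hi
    rw [hk i hi, hk M hMm] at h1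
    exact Nat.lt_of_mul_lt_mul_left (a := m) (by omega)
  have hdiv : ∀ i j, m * ((i + j) / m) + (i + j) % m = i + j := fun i j => Nat.div_add_mod _ _
  have hadd : ∀ i < m, ∀ j < m, k ((i + j) % m) ≤ k i + k j + (i + j) / m := fun i hi j hj => by
    have h1 := apery_add_le hS hi hj
    rw [hk i hi, hk j hj, hk _ (Nat.mod_lt _ hm0)] at h1
    refine le_of_mul_le_mul_left (a := m) ?_ hm0
    have := hdiv i j
    rw [mul_add, mul_add]
    omega
  have hdec : ∀ i < m, 0 < i → apery S m i ∉ minGenerators S → ∃ j < m, ∃ l < m,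
      0 < j ∧ j ≤ l ∧ (j + l) % m = i ∧ k i = k j + k l + (j + l) / m := fun i hi hi0 h => by
    obtain ⟨j, hj, l, hl, hj0, hl0, hjl, h⟩ := exists_apery_add_of_notMem_minGenerators hS hi hi0 h
    have hsum : k i = k j + k l + (j + l) / m := by
      rw [hk i hi, hk j hj, hk l hl] at h
      refine Nat.eq_of_mul_eq_mul_left hm0 ?_
      have := hdiv j l
      rw [mul_add, mul_add]
      omega
    rcases le_total j l with h' | h'
    · exact ⟨j, hj, l, hl, hj0, h', hjl, hsum⟩
    · exact ⟨l, hl, j, hj, hl0, h', by rwa [add_comm], by rw [add_comm l, add_comm (k l), hsum]⟩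
  have hfk : frobeniusNumber S = m * k M + M - m := by
    rw [hk M hMm] at hMf
    push_cast at hMf
    omega
  -- Since `f = m * (k M - 1) + M`, `m * q + i < f` means `q < k M` for `i < M` and `q < k M - 1`
  -- for `i > M`. For `i = M` the range from `k M` to `k M` is empty.
  have hn := sum_le_numSmall (b := fun i => if i ≤ M then k M else k M - 1) hS hmS hm0 hk
    fun i hi q hkq hq => by
      rw [hfk]
      push_cast
      split_ifs at hq with h
      · rcases h.lt_or_eq with h | rfl
        · nlinarith
        · omega
      · nlinarith [show q + 2 ≤ k M by omega]
  have hw := wilf_kunz (k := fun i => (k i : ℤ)) (M := M)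
    (g := fun i => ((if apery S m i ∈ minGenerators S then 1 else 0 : ℕ) : ℤ)) hm hM0 hMm
    (by exact_mod_cast hk0) (by exact_mod_cast hkpos) (by exact_mod_cast hadd)
    (fun i hi _ => by exact_mod_cast hle i hi) (by exact_mod_cast hlt)
    (fun i hi hi0 => by
      by_cases h : apery S m i ∈ minGenerators S
      · simp [h]
      · right
        refine ⟨by simp [h], ?_⟩
        exact_mod_cast hdec i hi hi0 h)
  -- Truncated subtraction in `hn` can only exceed the integer difference.
  have hA : ∑ i ∈ Finset.range m, ((if i ≤ M then (k M : ℤ) else k M - 1) - k i) ≤ numSmall S := by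
    refine le_trans ?_ (Nat.cast_le.2 hn)
    rw [Nat.cast_sum]
    refine Finset.sum_le_sum fun i hi => ?_
    split_ifs <;> omega
  have hB : 1 + ∑ i ∈ Finset.Ico 1 m,
      ((if apery S m i ∈ minGenerators S then 1 else 0 : ℕ) : ℤ) ≤ embDim S := by
    exact_mod_cast hν
  calc frobeniusNumber S + 1 = m * (k M - 1) + M + 1 := by rw [hfk]; ring
    _ ≤ _ := hw
    _ ≤ _ := mul_le_mul hA hB (by positivity) (by positivity)
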